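/- Let $n,m\ge 1$ be integers, let $T>0$ and $L>0$ be real numbers, and let $F$ be an arbitrary (in general nonlinear) operator from $C([0,T],\mathbb{R}^m)$, the space of continuous functions, to $L_\infty([0,T],\mathbb{R}^m)$, the space of (classes of) measurable essentially bounded functions. Suppose that for every $x\in C([0,T],\mathbb{R}^m)$ $$\max_{i=1,\dots,m}\Bigl(\operatorname*{ess\,sup}_{t\in[0,T]}(Fx)_i(t)-\operatorname*{ess\,inf}_{t\in[0,T]}(Fx)_i(t)\Bigr)\le L\max_{i=1,\dots,m}\Bigl(\max_{t\in[0,T]}x_i(t)-\min_{t\in[0,T]}x_i(t)\Bigr).$$ Define $$K_n=\frac{(2^{n+1}-1)\,|B_{n+1}|}{2^{n-1}(n+1)!}\ \text{ if $n$ is odd},\qquad K_n=\frac{|E_n|}{4^n\,n!}\ \text{ if $n$ is even},$$ where $B_k$ are the Bernoulli numbers and $E_k$ are the Euler numbers, $\frac{1}{\cosh t}=\sum_{k\ge0}E_k\frac{t^k}{k!}$. If the periodic boundary value problem $$x^{(n)}(t)=(Fx)(t)\ \text{ for almost all } t\in[0,T],\qquad x^{(i)}(0)=x^{(i)}(T),\quad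 i=0,\dots,n-1,$$ has a non-constant solution $x:[0,T]\to\mathbb{R}^m$ whose derivatives up to order $n-1$ exist and are absolutely continuous on $[0,T]$, then $$T\ge\frac{1}{(L\,K_n)^{1/n}}.$$ -/

import Mathlib

open Set MeasureTheory

noncomputable section

/-- The Euler numbers `E_n`, given by the exponential generating function
`1 / cosh t = ∑ E_n t^n / n!` (so `E_0 = 1`, `E_2 = -1`, `E_4 = 5`, `E_6 = -61`, and `E_n = 0`
for odd `n`); here `cosh t = (e^t + e^{-t}) / 2` as a formal power series. -/
def eulerNumber (n : ℕ) : ℚ :=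
  (n.factorial : ℚ) * PowerSeries.coeff n
    (PowerSeries.C (1 / 2 : ℚ) *
      (PowerSeries.exp ℚ + PowerSeries.evalNegHom (PowerSeries.exp ℚ)))⁻¹

/-- The rational constants `K_n`, `n ≥ 1`: for odd `n`,
`(2^{n+1} - 1) |B_{n+1}| / (2^{n-1} (n+1)!)`, and for even `n`, `|E_n| / (4^n n!)`. -/
def favardConst (n : ℕ) : ℚ :=
  if Odd n then
    (2 ^ (n + 1) - 1) * |bernoulli (n + 1)| / (2 ^ (n - 1) * ((n + 1).factorial : ℚ))
  else |eulerNumber n| / (4 ^ n * (n.factorial : ℚ))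

/-- Lebesgue measure on `[0, T]`. -/
abbrev volIcc (T : ℝ) : Measure ℝ := volume.restrict (Icc 0 T)

/-- `C([0,T], ℝ^m)`. -/
abbrev ContSpace (T : ℝ) (m : ℕ) : Type := C(Icc (0 : ℝ) T, Fin m → ℝ)

/-- `L_∞([0,T], ℝ^m)`, with the norm `max_i vrai sup_t |z_i(t)|`. -/
abbrev LInfSpace (T : ℝ) (m : ℕ) : Type := Lp (Fin m → ℝ) ⊤ (volIcc T)

/-- `max_i (max_{t ∈ [0,T]} x_i(t) - min_{t ∈ [0,T]} x_i(t))`. -/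
def maxOsc {T : ℝ} {m : ℕ} (x : ContSpace T m) : ℝ :=
  ⨆ i : Fin m, ((⨆ t : Icc (0 : ℝ) T, x t i) - ⨅ t : Icc (0 : ℝ) T, x t i)

/-- `max_i (vrai sup_{t ∈ [0,T]} z_i(t) - vrai inf_{t ∈ [0,T]} z_i(t))`. -/
def maxEssOsc {T : ℝ} {m : ℕ} (z : LInfSpace T m) : ℝ :=
  ⨆ i : Fin m,
    (essSup (fun t : ℝ => z t i) (volIcc T) - essInf (fun t : ℝ => z t i) (volIcc T))

/-- The `i`-th derivative of `x` on `[0,T]` (one-sided at the end points), as a function on `ℝ` of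
which only the values on `[0,T]` matter. -/
def derivOn {T : ℝ} {m : ℕ} (hT : 0 < T) (i : ℕ) (x : ContSpace T m) : ℝ → Fin m → ℝ :=
  iteratedDerivWithin i (IccExtend hT.le x) (Icc 0 T)

/-- `x ∈ AC^{n-1}([0,T], ℝ^m)`: the derivatives of `x` of orders `0, …, n-1` exist on `[0,T]` and
are absolutely continuous. -/
def IsAC {T : ℝ} {m : ℕ} (hT : 0 < T) (n : ℕ) (x : ContSpace T m) : Prop :=
  (∀ i, i + 1 < n → DifferentiableOn ℝ (derivOn hT i x) (Icc 0 T)) ∧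
  ∀ i, i < n → AbsolutelyContinuousOnInterval (derivOn hT i x) 0 T

/-- `x` solves `x^{(n)}(t) = (F x)(t)` for almost all `t ∈ [0,T]`,
`x^{(i)}(0) = x^{(i)}(T)` for `i = 0, …, n-1`, in the class `AC^{n-1}([0,T], ℝ^m)`. -/
structure IsPeriodicSolution {T : ℝ} {m : ℕ} (hT : 0 < T) (n : ℕ)
    (F : ContSpace T m → LInfSpace T m) (x : ContSpace T m) : Prop where
  ac : IsAC hT n x
  eqn : ∀ᵐ t ∂(volIcc T), derivOn hT n x t = F x t
  periodic : ∀ i, i < n → derivOn hT i x 0 = derivOn hT i x T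

end

/-! The proof rests on a sharp oscillation estimate: a component `f` of a periodic solution
satisfies `osc f ≤ K_n T^n · ess osc f^(n)`. Combined with the Lipschitz condition and `osc x > 0`,
it gives `1 ≤ L K_n T^n`.

Let `P_k` be the periodized `B_k / k!`. Repeated integration by parts gives `f(t) = mean - T^(n-1) ∫
P_n((t-s)/T) f^(n)(s) ds` (`PeriodicChain.eq_mean_sub_bernoulliTransform`). In `f(p) - f(q)` the
mean drops out, and since `P_n` has integral zero, `f^(n)` may be recentred at the midpoint of its
range. The estimate (`PeriodicChain.abs_sub_le`) thus reduces to bounding the `L¹` norm of `D_n(v) =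
P_n(v+a) - P_n(v-a)` over a period by `2 K_n` (`integral_abs_bernoulliDiff_le`).

By symmetry half a period suffices. For even `n`, `D_n` has constant sign there, so its integral is
an endpoint difference of `D_(n+1)`, largest at `a = 1/4`. For odd `n`, `D_n` is monotone there and
its primitive `D_(n+1)` vanishes at both ends, so the oscillation of `P_(n+1)` controls the norm.
The resulting values of Bernoulli polynomials are `K_n` (`favardConst_odd`, `favardConst_even`). -/

/-! ### Signs and monotonicity of Bernoulli polynomials on `[0, 1/2]` -/

/-- The normalized Bernoulli polynomials `B_k / k!`, each a primitive of the preceding one. -/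
noncomputable def normBernoulli (k : ℕ) (t : ℝ) : ℝ := bernoulliFun k t / (k.factorial : ℝ)

theorem hasDerivAt_normBernoulli (k : ℕ) (t : ℝ) :
    HasDerivAt (normBernoulli (k + 1)) (normBernoulli k t) t := by
  have h : HasDerivAt (normBernoulli (k + 1)) _ t :=
    (hasDerivAt_bernoulliFun (k + 1) t).div_const ((k + 1).factorial : ℝ)
  convert h using 1
  rw [normBernoulli, Nat.factorial_succ, Nat.add_sub_cancel]
  push_cast
  have : (k.factorial : ℝ) ≠ 0 := by positivity
  have : (k + 1 : ℝ) ≠ 0 := by positivity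
  field_simp

@[fun_prop]
theorem continuous_normBernoulli (k : ℕ) : Continuous (normBernoulli k) := by
  unfold normBernoulli
  fun_prop

theorem normBernoulli_zero (t : ℝ) : normBernoulli 0 t = 1 := by simp [normBernoulli]

theorem normBernoulli_one (t : ℝ) : normBernoulli 1 t = t - 1 / 2 := by simp [normBernoulli]

theorem normBernoulli_eval_one {k : ℕ} (hk : k ≠ 1) : normBernoulli k 1 = normBernoulli k 0 := by
  simp [normBernoulli, bernoulliFun_endpoints_eq_of_ne_one hk]

theorem normBernoulli_one_sub (k : ℕ) (t : ℝ) :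
    normBernoulli k (1 - t) = (-1) ^ k * normBernoulli k t := by
  simp only [normBernoulli, bernoulliFun_eval_one_sub]
  ring

theorem normBernoulli_odd_zero (j : ℕ) : normBernoulli (2 * j + 3) 0 = 0 := by
  have h := normBernoulli_one_sub (2 * j + 3) 0
  rw [sub_zero, normBernoulli_eval_one (by omega), Odd.neg_one_pow ⟨j + 1, by ring⟩] at h
  linarith

theorem normBernoulli_odd_half (j : ℕ) : normBernoulli (2 * j + 1) (1 / 2) = 0 := by
  have h := normBernoulli_one_sub (2 * j + 1) (1 / 2)
  rw [Odd.neg_one_pow ⟨j, rfl⟩] at h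
  norm_num at h
  linarith

/-- On `[0, 1/2]` the sign of `B_{2j+1}` is that of `(-1)^{j+1}`. -/
theorem normBernoulli_odd_sign (j : ℕ) :
    ∀ t ∈ Icc (0 : ℝ) (1 / 2), (-1) ^ j * normBernoulli (2 * j + 1) t ≤ 0 := by
  induction j with
  | zero =>
    intro t ht
    simp only [pow_zero, one_mul, mul_zero, zero_add, normBernoulli_one]
    linarith [ht.2]
  | succ j ih =>
    have hd : ∀ (k : ℕ) (t : ℝ), HasDerivAt (fun t => (-1) ^ j * normBernoulli (k + 1) t)
        ((-1) ^ j * normBernoulli k t) t := fun k t =>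
      (hasDerivAt_normBernoulli k t).const_mul _
    have hanti : AntitoneOn (fun t => (-1) ^ j * normBernoulli (2 * j + 2) t)
        (Icc (0 : ℝ) (1 / 2)) := by
      apply antitoneOn_of_deriv_nonpos (convex_Icc _ _)
      · fun_prop
      · exact fun t _ => (hd _ t).differentiableAt.differentiableWithinAt
      · intro t ht
        rw [(hd (2 * j + 1) t).deriv]
        exact ih t (interior_subset ht)
    have hconc : ConcaveOn ℝ (Icc (0 : ℝ) (1 / 2))
        (fun t => (-1) ^ j * normBernoulli (2 * j + 3) t) := by
      apply AntitoneOn.concaveOn_of_deriv (convex_Icc _ _)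
      · fun_prop
      · exact fun t _ => (hd _ t).differentiableAt.differentiableWithinAt
      · intro s hs t ht hst
        rw [(hd (2 * j + 2) t).deriv, (hd (2 * j + 2) s).deriv]
        exact hanti (interior_subset hs) (interior_subset ht) hst
    intro t ht
    -- A concave function vanishing at `0` and `1/2` is nonnegative between; `t` is the convex
    -- combination with weights `1 - 2t` and `2t`.
    obtain ⟨-, hc⟩ := hconc
    have h := @hc 0 (by simp) (1 / 2) (by simp) (1 - 2 * t) (2 * t) (by linarith [ht.2])
      (by linarith [ht.1]) (by ring)
    have h3 : normBernoulli (2 * j + 3) (1 / 2) = 0 := normBernoulli_odd_half (j + 1)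
    have e : 2 * t * (1 / 2) = t := by ring
    simp only [smul_eq_mul, normBernoulli_odd_zero, h3, mul_zero, add_zero, zero_add] at h
    rw [e] at h
    have e2 : 2 * (j + 1) + 1 = 2 * j + 3 := by ring
    rw [e2, pow_succ]
    linarith

theorem normBernoulli_even_antitoneOn (j : ℕ) :
    AntitoneOn (fun t => (-1) ^ j * normBernoulli (2 * j + 2) t) (Icc (0 : ℝ) (1 / 2)) := by
  have hd : ∀ t : ℝ, HasDerivAt (fun t => (-1) ^ j * normBernoulli (2 * j + 2) t)
      ((-1) ^ j * normBernoulli (2 * j + 1) t) t := fun t =>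
    (hasDerivAt_normBernoulli _ t).const_mul _
  apply antitoneOn_of_deriv_nonpos (convex_Icc _ _)
  · fun_prop
  · exact fun t _ => (hd t).differentiableAt.differentiableWithinAt
  · intro t ht
    rw [(hd t).deriv]
    exact normBernoulli_odd_sign j t (interior_subset ht)

/-! ### Periodized Bernoulli functions -/

/-- The `1`-periodic extension of `B_k / k!` from `[0, 1)`. -/
noncomputable def perBernoulli (k : ℕ) (t : ℝ) : ℝ := normBernoulli k (Int.fract t)

theorem perBernoulli_periodic (k : ℕ) : Function.Periodic (perBernoulli k) 1 := fun t => by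
  simp [perBernoulli]

theorem perBernoulli_of_mem_Ico {k : ℕ} {t : ℝ} (ht : t ∈ Ico (0 : ℝ) 1) :
    perBernoulli k t = normBernoulli k t := by
  rw [perBernoulli, Int.fract_eq_self.2 ht]

theorem perBernoulli_of_mem_Icc {k : ℕ} (hk : k ≠ 1) {t : ℝ} (ht : t ∈ Icc (0 : ℝ) 1) :
    perBernoulli k t = normBernoulli k t := by
  rcases ht.2.lt_or_eq with h | rfl
  · exact perBernoulli_of_mem_Ico ⟨ht.1, h⟩
  · simp [perBernoulli, normBernoulli_eval_one hk]

theorem continuous_perBernoulli {k : ℕ} (hk : k ≠ 1) : Continuous (perBernoulli k) := by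
  have := ContinuousOn.comp_fract'' (f := normBernoulli k)
    (continuous_normBernoulli k).continuousOn (normBernoulli_eval_one hk).symm
  exact this

theorem measurable_perBernoulli (k : ℕ) : Measurable (perBernoulli k) :=
  (continuous_normBernoulli k).measurable.comp measurable_fract

theorem exists_abs_perBernoulli_le (k : ℕ) : ∃ C, ∀ t, |perBernoulli k t| ≤ C := by
  obtain ⟨C, hC⟩ := isCompact_Icc.exists_bound_of_continuousOn
    (continuous_normBernoulli k).continuousOn (s := Icc (0 : ℝ) 1)
  exact ⟨C, fun t => hC _ ⟨Int.fract_nonneg t, (Int.fract_lt_one t).le⟩⟩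

theorem intervalIntegrable_of_measurable_of_bound {g : ℝ → ℝ} (hg : Measurable g) {C : ℝ}
    (hC : ∀ t, |g t| ≤ C) (u v : ℝ) : IntervalIntegrable g volume u v := by
  rw [intervalIntegrable_iff]
  exact Measure.integrableOn_of_bounded (M := C) (by simp) hg.aestronglyMeasurable
    (Filter.Eventually.of_forall hC)

theorem intervalIntegrable_perBernoulli (k : ℕ) (u v : ℝ) :
    IntervalIntegrable (perBernoulli k) volume u v := by
  obtain ⟨C, hC⟩ := exists_abs_perBernoulli_le k
  exact intervalIntegrable_of_measurable_of_bound (measurable_perBernoulli k) hC u v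

theorem integral_perBernoulli {k : ℕ} (hk : 1 ≤ k) (u v : ℝ) :
    ∫ t in u..v, perBernoulli k t = perBernoulli (k + 1) v - perBernoulli (k + 1) u := by
  -- Right derivatives suffice and hold at integers too, where for `k = 1` the integrand jumps.
  apply intervalIntegral.integral_eq_sub_of_hasDeriv_right
    (continuous_perBernoulli (by omega)).continuousOn _ (intervalIntegrable_perBernoulli k u v)
  intro t _
  have h1 : HasDerivAt (fun s => normBernoulli (k + 1) (s - ⌊t⌋)) (perBernoulli k t) t := by
    have := (hasDerivAt_normBernoulli k (t - ⌊t⌋)).comp_sub_const t (⌊t⌋ : ℝ)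
    exact this
  refine h1.hasDerivWithinAt.congr_of_eventuallyEq ?_ rfl
  have : Ico (⌊t⌋ : ℝ) (⌊t⌋ + 1) ∈ nhdsWithin t (Ioi t) := by
    refine Filter.mem_of_superset (Ioo_mem_nhdsGT (Int.lt_floor_add_one t)) fun s hs => ?_
    exact ⟨(Int.floor_le t).trans hs.1.le, hs.2⟩
  filter_upwards [this] with s hs
  have : ⌊s⌋ = ⌊t⌋ := Int.floor_eq_iff.2 hs
  simp [perBernoulli, Int.fract, this]

theorem perBernoulli_neg {k : ℕ} {t : ℝ} (h : k ≠ 1 ∨ Int.fract t ≠ 0) :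
    perBernoulli k (-t) = (-1) ^ k * perBernoulli k t := by
  by_cases h0 : Int.fract t = 0
  · have hk : k ≠ 1 := by tauto
    have h0' : Int.fract (-t) = 0 := Int.fract_neg_eq_zero.2 h0
    rw [perBernoulli, perBernoulli, h0, h0', ← normBernoulli_one_sub, sub_zero,
      normBernoulli_eval_one hk]
  · rw [perBernoulli, perBernoulli, Int.fract_neg h0, normBernoulli_one_sub]

/-! ### Symmetric differences of the kernel -/

/-- The symmetric difference with step `2 a` of the periodized Bernoulli function. -/
noncomputable def bernoulliDiff (a : ℝ) (k : ℕ) (v : ℝ) : ℝ :=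
  perBernoulli k (v + a) - perBernoulli k (v - a)

theorem bernoulliDiff_periodic (a : ℝ) (k : ℕ) : Function.Periodic (bernoulliDiff a k) 1 := by
  intro v
  have h1 : v + 1 + a = v + a + 1 := by ring
  have h2 : v + 1 - a = v - a + 1 := by ring
  rw [bernoulliDiff, bernoulliDiff, h1, h2, perBernoulli_periodic, perBernoulli_periodic]

theorem intervalIntegrable_perBernoulli_comp {f : ℝ → ℝ} (hf : Measurable f) (k : ℕ) (u v : ℝ) :
    IntervalIntegrable (fun t => perBernoulli k (f t)) volume u v := by
  obtain ⟨C, hC⟩ := exists_abs_perBernoulli_le k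
  exact intervalIntegrable_of_measurable_of_bound ((measurable_perBernoulli k).comp hf)
    (fun t => hC _) u v

theorem intervalIntegrable_bernoulliDiff (a : ℝ) (k : ℕ) (u v : ℝ) :
    IntervalIntegrable (bernoulliDiff a k) volume u v :=
  (intervalIntegrable_perBernoulli_comp (measurable_add_const a) k u v).sub
    (intervalIntegrable_perBernoulli_comp (measurable_sub_const a) k u v)

theorem integral_bernoulliDiff (a : ℝ) {k : ℕ} (hk : 1 ≤ k) (u v : ℝ) :
    ∫ t in u..v, bernoulliDiff a k t = bernoulliDiff a (k + 1) v - bernoulliDiff a (k + 1) u := by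
  unfold bernoulliDiff
  rw [intervalIntegral.integral_sub
    (intervalIntegrable_perBernoulli_comp (measurable_add_const a) k u v)
    (intervalIntegrable_perBernoulli_comp (measurable_sub_const a) k u v),
    intervalIntegral.integral_comp_add_right, intervalIntegral.integral_comp_sub_right,
    integral_perBernoulli hk, integral_perBernoulli hk]
  ring

theorem perBernoulli_even_neg (j : ℕ) (t : ℝ) :
    perBernoulli (2 * j + 2) (-t) = perBernoulli (2 * j + 2) t := by
  rw [perBernoulli_neg (Or.inl (by omega)), Even.neg_one_pow ⟨j + 1, by ring⟩, one_mul]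

/-- Up to sign, the even kernel decreases with the distance to the nearest integer, and `u - a` is
at least as close to an integer as `u + a`: `|u - a|` is at most both `u + a` and `1 - (u + a)`. -/
theorem bernoulliDiff_even_sign (j : ℕ) {a u : ℝ} (ha : a ∈ Icc (0 : ℝ) (1 / 2))
    (hu : u ∈ Icc (0 : ℝ) (1 / 2)) : (-1) ^ j * bernoulliDiff a (2 * j + 2) u ≤ 0 := by
  obtain ⟨ha0, ha1⟩ := ha
  obtain ⟨hu0, hu1⟩ := hu
  have hd : |u - a| ≤ 1 / 2 := abs_le.2 ⟨by linarith, by linarith⟩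
  have h1 : perBernoulli (2 * j + 2) (u - a) = normBernoulli (2 * j + 2) |u - a| := by
    rw [← perBernoulli_of_mem_Icc (by omega) ⟨abs_nonneg _, by linarith⟩]
    rcases abs_choice (u - a) with h | h <;> rw [h]
    exact (perBernoulli_even_neg j _).symm
  have h2 : perBernoulli (2 * j + 2) (u + a) = normBernoulli (2 * j + 2) (u + a) :=
    perBernoulli_of_mem_Icc (by omega) ⟨by linarith, by linarith⟩
  rw [bernoulliDiff, h1, h2, mul_sub, sub_nonpos]
  have hanti := normBernoulli_even_antitoneOn j
  rcases le_total (u + a) (1 / 2) with h | h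
  · exact hanti ⟨abs_nonneg _, hd⟩ ⟨by linarith, h⟩ (abs_le.2 ⟨by linarith, by linarith⟩)
  · have h3 := normBernoulli_one_sub (2 * j + 2) (u + a)
    rw [Even.neg_one_pow ⟨j + 1, by ring⟩, one_mul] at h3
    rw [← h3]
    exact hanti ⟨abs_nonneg _, hd⟩ ⟨by linarith, by linarith⟩
      (abs_le.2 ⟨by linarith, by linarith⟩)

theorem bernoulliDiff_one {a u : ℝ} (ha : a ∈ Icc (0 : ℝ) (1 / 2))
    (hu : u ∈ Icc (0 : ℝ) (1 / 2)) :
    bernoulliDiff a 1 u = if u < a ∨ u + a = 1 then 2 * a - 1 else 2 * a := by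
  obtain ⟨ha0, ha1⟩ := ha
  obtain ⟨hu0, hu1⟩ := hu
  simp only [bernoulliDiff, perBernoulli, normBernoulli_one]
  by_cases h1 : u + a = 1
  · have : u = 1 / 2 := by linarith
    have : a = 1 / 2 := by linarith
    subst u a
    norm_num
  · have h2 : Int.fract (u + a) = u + a :=
      Int.fract_eq_self.2 ⟨by linarith, lt_of_le_of_ne (by linarith) h1⟩
    by_cases h3 : u < a
    · have h4 : Int.fract (u - a) = u - a + 1 := by
        rw [← Int.fract_add_one, Int.fract_eq_self.2 ⟨by linarith, by linarith⟩]
      rw [if_pos (Or.inl h3), h2, h4]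
      ring
    · have h4 : Int.fract (u - a) = u - a :=
        Int.fract_eq_self.2 ⟨by linarith, by linarith⟩
      rw [if_neg (by tauto), h2, h4]
      ring

/-- Beyond index `1`, the function is a primitive of an even-index difference, whose sign is
constant; at index `1` it is an explicit step function. -/
theorem bernoulliDiff_odd_monotoneOn (j : ℕ) {a : ℝ} (ha : a ∈ Icc (0 : ℝ) (1 / 2)) :
    MonotoneOn (fun v => (-1) ^ j * bernoulliDiff a (2 * j + 1) v) (Icc (0 : ℝ) (1 / 2)) := by
  intro u hu v hv huv
  rcases j with _ | j
  · simp only [pow_zero, one_mul, mul_zero, zero_add]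
    rw [bernoulliDiff_one ha hu, bernoulliDiff_one ha hv]
    obtain ⟨ha0, ha1⟩ := ha
    obtain ⟨hu0, hu1⟩ := hu
    obtain ⟨hv0, hv1⟩ := hv
    split_ifs with h1 h2 h2 <;> try linarith
    rcases h2 with h2 | h2
    · exact absurd (Or.inl (huv.trans_lt h2)) h1
    · rw [not_or, not_lt] at h1
      exact absurd (by linarith) h1.2
  · have h := integral_bernoulliDiff a (k := 2 * j + 2) (by omega) u v
    have h2 : 0 ≤ ∫ t in u..v, -((-1) ^ j * bernoulliDiff a (2 * j + 2) t) := by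
      apply intervalIntegral.integral_nonneg huv
      intro t ht
      exact neg_nonneg.2 (bernoulliDiff_even_sign j ha ⟨hu.1.trans ht.1, ht.2.trans hv.2⟩)
    rw [intervalIntegral.integral_neg, intervalIntegral.integral_const_mul, h] at h2
    simp only [pow_succ]
    have e : 2 * (j + 1) + 1 = 2 * j + 2 + 1 := by ring
    rw [e]
    linarith

/-! ### `L¹` norms of the symmetric differences -/

/-- The `L¹` norm of a monotone function whose primitive vanishes at both ends. -/
theorem integral_abs_le_of_monotoneOn {g : ℝ → ℝ} {c ω : ℝ} (hc : 0 ≤ c)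
    (hg : MonotoneOn g (Icc 0 c)) (hω : ∀ v ∈ Icc 0 c, |∫ t in 0..v, g t| ≤ ω)
    (h0 : ∫ t in 0..c, g t = 0) : ∫ t in 0..c, |g t| ≤ 2 * ω := by
  obtain ⟨s, hs, hneg, hpos⟩ : ∃ s ∈ Icc 0 c, (∀ v ∈ Ioo 0 s, g v ≤ 0) ∧
      ∀ v ∈ Ioo s c, 0 ≤ g v := by
    -- The supremum of `A` is where `g` changes sign; inserting `0` keeps `A` nonempty when `g` is
    -- positive throughout.
    set A : Set ℝ := insert 0 {v | v ∈ Icc 0 c ∧ g v ≤ 0}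
    have hA : ∀ v ∈ A, v ≤ c := by
      rintro v (rfl | hv)
      exacts [hc, hv.1.2]
    have hbdd : BddAbove A := ⟨c, hA⟩
    have hs0 : 0 ≤ sSup A := le_csSup hbdd (mem_insert _ _)
    have hsc : sSup A ≤ c := csSup_le ⟨0, mem_insert _ _⟩ hA
    refine ⟨sSup A, ⟨hs0, hsc⟩, fun v hv => ?_, fun v hv => ?_⟩
    · obtain ⟨w, hw, hvw⟩ := exists_lt_of_lt_csSup ⟨0, mem_insert _ _⟩ hv.2
      rcases hw with rfl | hw
      · exact absurd hvw hv.1.le.not_gt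
      · exact (hg ⟨hv.1.le, hvw.le.trans hw.1.2⟩ hw.1 hvw.le).trans hw.2
    · by_contra! h
      exact (le_csSup hbdd (Or.inr ⟨⟨hs0.trans hv.1.le, hv.2.le⟩, h.le⟩)).not_gt hv.1
  have hi : ∀ u ∈ Icc 0 c, ∀ v ∈ Icc 0 c, IntervalIntegrable g volume u v := fun u hu v hv =>
    (hg.mono (uIcc_subset_Icc hu hv)).intervalIntegrable
  have m0 : (0 : ℝ) ∈ Icc 0 c := ⟨le_rfl, hc⟩
  have mc : c ∈ Icc 0 c := ⟨hc, le_rfl⟩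
  have e1 : ∫ t in 0..s, |g t| = -∫ t in 0..s, g t := by
    rw [← intervalIntegral.integral_neg]
    exact intervalIntegral.integral_congr_Ioo_of_le hs.1 fun v hv => abs_of_nonpos (hneg v hv)
  have e2 : ∫ t in s..c, |g t| = ∫ t in s..c, g t :=
    intervalIntegral.integral_congr_Ioo_of_le hs.2 fun v hv => abs_of_nonneg (hpos v hv)
  have e3 := intervalIntegral.integral_add_adjacent_intervals (hi 0 m0 s hs) (hi s hs c mc)
  rw [← intervalIntegral.integral_add_adjacent_intervals (hi 0 m0 s hs).abs (hi s hs c mc).abs,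
    e1, e2]
  have := (abs_le.1 (hω s hs)).1
  linarith

/-- Reflection can fail only for `k = 1` at the jumps, so a countable set is discarded. -/
theorem bernoulliDiff_neg_ae (a : ℝ) (k : ℕ) :
    ∀ᵐ v : ℝ, |bernoulliDiff a k (-v)| = |bernoulliDiff a k v| := by
  have hZ : ∀ c : ℝ, ∀ᵐ v : ℝ, Int.fract (v + c) ≠ 0 := fun c => by
    have hcount : (range fun z : ℤ => (z : ℝ) - c).Countable := countable_range _
    filter_upwards [hcount.ae_notMem volume] with v hv h0
    obtain ⟨z, hz⟩ := Int.fract_eq_zero_iff.1 h0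
    exact hv ⟨z, by simp [hz]⟩
  filter_upwards [hZ a, hZ (-a)] with v h1 h2
  have e1 : -v + a = -(v + -a) := by ring
  have e2 : -v - a = -(v + a) := by ring
  rw [bernoulliDiff, bernoulliDiff, e1, e2, perBernoulli_neg (Or.inr h1),
    perBernoulli_neg (Or.inr h2), ← mul_sub, abs_mul, abs_pow, abs_neg, abs_one, one_pow,
    one_mul, abs_sub_comm, sub_eq_add_neg v a]

theorem integral_abs_bernoulliDiff (a : ℝ) (k : ℕ) :
    ∫ v in (0 : ℝ)..1, |bernoulliDiff a k v| =
      2 * ∫ v in (0 : ℝ)..(1 / 2), |bernoulliDiff a k v| := by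
  have hp : Function.Periodic (fun v => |bernoulliDiff a k v|) 1 := fun v => by
    simp only [bernoulliDiff_periodic a k v]
  have h1 := hp.intervalIntegral_add_eq 0 (-(1 / 2))
  have h2 : ∫ v in (-(1 / 2) : ℝ)..0, |bernoulliDiff a k v| =
      ∫ v in (0 : ℝ)..(1 / 2), |bernoulliDiff a k v| := by
    have h := intervalIntegral.integral_comp_neg (a := (0 : ℝ)) (b := 1 / 2)
      (fun v => |bernoulliDiff a k v|)
    rw [neg_zero] at h
    rw [← h]
    apply intervalIntegral.integral_congr_ae
    filter_upwards [bernoulliDiff_neg_ae a k] with v hv _ using hv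
  have e : (-(1 / 2) : ℝ) + 1 = 1 / 2 := by norm_num
  rw [zero_add, e] at h1
  rw [h1, ← intervalIntegral.integral_add_adjacent_intervals (b := 0)
    (intervalIntegrable_bernoulliDiff a k _ _).abs (intervalIntegrable_bernoulliDiff a k _ _).abs,
    h2]
  ring

theorem perBernoulli_even_mem_uIcc (j : ℕ) (t : ℝ) : (-1) ^ j * perBernoulli (2 * j + 2) t ∈
    Icc ((-1) ^ j * normBernoulli (2 * j + 2) (1 / 2)) ((-1) ^ j * normBernoulli (2 * j + 2) 0) := by
  have key : ∀ s ∈ Icc (0 : ℝ) (1 / 2), (-1) ^ j * normBernoulli (2 * j + 2) s ∈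
      Icc ((-1) ^ j * normBernoulli (2 * j + 2) (1 / 2))
        ((-1) ^ j * normBernoulli (2 * j + 2) 0) := fun s hs =>
    ⟨normBernoulli_even_antitoneOn j hs (by simp) hs.2,
      normBernoulli_even_antitoneOn j (by simp) hs hs.1⟩
  have h0 := Int.fract_nonneg t
  have h1 := (Int.fract_lt_one t).le
  rw [perBernoulli]
  rcases le_total (Int.fract t) (1 / 2) with h | h
  · exact key _ ⟨h0, h⟩
  · have h3 := normBernoulli_one_sub (2 * j + 2) (Int.fract t)
    rw [Even.neg_one_pow ⟨j + 1, by ring⟩, one_mul] at h3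
    rw [← h3]
    exact key _ ⟨by linarith, by linarith⟩

/-- The primitive, an even-index difference, vanishes at `0` by evenness and at `1/2` by evenness
and periodicity. It never exceeds the oscillation of the even kernel, whose extremes are at `0` and
`1/2`. -/
theorem integral_abs_bernoulliDiff_odd_le (j : ℕ) {a : ℝ} (ha : a ∈ Icc (0 : ℝ) (1 / 2)) :
    ∫ v in (0 : ℝ)..(1 / 2), |bernoulliDiff a (2 * j + 1) v| ≤
      2 * |normBernoulli (2 * j + 2) 0 - normBernoulli (2 * j + 2) (1 / 2)| := by
  have habs : ∀ x : ℝ, |(-1) ^ j * x| = |x| := fun x => by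
    rw [abs_mul, abs_pow, abs_neg, abs_one, one_pow, one_mul]
  have hz : bernoulliDiff a (2 * j + 2) 0 = 0 := by
    rw [bernoulliDiff, zero_add, zero_sub, perBernoulli_even_neg, sub_self]
  have hI : ∀ v, ∫ t in (0 : ℝ)..v, (-1) ^ j * bernoulliDiff a (2 * j + 1) t =
      (-1) ^ j * bernoulliDiff a (2 * j + 2) v := fun v => by
    rw [intervalIntegral.integral_const_mul, integral_bernoulliDiff a (by omega), hz, sub_zero]
  have h := integral_abs_le_of_monotoneOn (by norm_num) (bernoulliDiff_odd_monotoneOn j ha)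
    (ω := |normBernoulli (2 * j + 2) 0 - normBernoulli (2 * j + 2) (1 / 2)|) ?_ ?_
  · simpa only [habs] using h
  · intro v _
    rw [hI, bernoulliDiff, mul_sub,
      ← habs (normBernoulli (2 * j + 2) 0 - normBernoulli (2 * j + 2) (1 / 2)), mul_sub]
    obtain ⟨h1, h2⟩ := perBernoulli_even_mem_uIcc j (v + a)
    obtain ⟨h3, h4⟩ := perBernoulli_even_mem_uIcc j (v - a)
    exact (abs_le.2 ⟨by linarith, by linarith⟩ : _ ≤ _).trans (le_abs_self _)
  · rw [hI]
    have e : (1 / 2 - a : ℝ) = -(1 / 2 + a) + 1 := by ring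
    rw [bernoulliDiff, e, perBernoulli_periodic, perBernoulli_even_neg, sub_self, mul_zero]

/-- The sum is symmetric under `a ↦ 1/2 - a` and, up to sign, increases on `[0, 1/4]` because the
even polynomials are monotone; hence the maximum is at `1/4`. -/
theorem normBernoulli_add_half_sub_le (j : ℕ) {a : ℝ} (ha : a ∈ Icc (0 : ℝ) (1 / 2)) :
    |normBernoulli (2 * j + 3) a + normBernoulli (2 * j + 3) (1 / 2 - a)| ≤
      2 * |normBernoulli (2 * j + 3) (1 / 4)| := by
  wlog h4 : a ≤ 1 / 4 generalizing a
  · have := this (a := 1 / 2 - a) ⟨by linarith [ha.2], by linarith [ha.1]⟩ (by linarith)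
    rwa [sub_sub_cancel, add_comm] at this
  have hs : ∀ t ∈ Icc (0 : ℝ) (1 / 2), 0 ≤ (-1) ^ j * normBernoulli (2 * j + 3) t :=
    fun t ht => by
      have := normBernoulli_odd_sign (j + 1) t ht
      rw [pow_succ] at this
      have e : 2 * (j + 1) + 1 = 2 * j + 3 := by ring
      rw [e] at this
      linarith
  have hd : ∀ t : ℝ, HasDerivAt (fun t => (-1) ^ j * (normBernoulli (2 * j + 3) t +
      normBernoulli (2 * j + 3) (1 / 2 - t)))
      ((-1) ^ j * (normBernoulli (2 * j + 2) t + -normBernoulli (2 * j + 2) (1 / 2 - t))) t :=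
    fun t => by
      have h1 := hasDerivAt_normBernoulli (2 * j + 2) t
      have h2 := (hasDerivAt_normBernoulli (2 * j + 2) (1 / 2 - t)).comp_const_sub (1 / 2) t
      exact (h1.add h2).const_mul _
  have hmono : MonotoneOn (fun t => (-1) ^ j * (normBernoulli (2 * j + 3) t +
      normBernoulli (2 * j + 3) (1 / 2 - t))) (Icc (0 : ℝ) (1 / 4)) := by
    apply monotoneOn_of_deriv_nonneg (convex_Icc _ _)
    · fun_prop
    · exact fun t _ => (hd t).differentiableAt.differentiableWithinAt
    · intro t ht
      rw [(hd t).deriv]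
      have ht' := interior_subset ht
      have := normBernoulli_even_antitoneOn j (a := t) (b := 1 / 2 - t)
        ⟨ht'.1, by linarith [ht'.2]⟩ ⟨by linarith [ht'.2], by linarith [ht'.1]⟩
        (by linarith [ht'.2])
      simp only at this
      linarith
  have h := hmono ⟨ha.1, h4⟩ ⟨by norm_num, le_rfl⟩ h4
  have e : (1 / 2 - 1 / 4 : ℝ) = 1 / 4 := by norm_num
  simp only [e] at h
  have habs : ∀ x : ℝ, |(-1) ^ j * x| = |x| := fun x => by
    rw [abs_mul, abs_pow, abs_neg, abs_one, one_pow, one_mul]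
  have h1 := hs a ha
  have h2 := hs (1 / 2 - a) ⟨by linarith [ha.2], by linarith [ha.1]⟩
  rw [← habs, ← habs (normBernoulli (2 * j + 3) (1 / 4)), abs_of_nonneg (by linarith),
    abs_of_nonneg (hs _ (by norm_num))]
  linarith

theorem integral_abs_bernoulliDiff_even_le (j : ℕ) {a : ℝ} (ha : a ∈ Icc (0 : ℝ) (1 / 2)) :
    ∫ v in (0 : ℝ)..(1 / 2), |bernoulliDiff a (2 * j + 2) v| ≤
      4 * |normBernoulli (2 * j + 3) (1 / 4)| := by
  have habs : ∀ x : ℝ, |(-1) ^ j * x| = |x| := fun x => by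
    rw [abs_mul, abs_pow, abs_neg, abs_one, one_pow, one_mul]
  have h1 : ∫ v in (0 : ℝ)..(1 / 2), |bernoulliDiff a (2 * j + 2) v| =
      ∫ v in (0 : ℝ)..(1 / 2), -((-1) ^ j * bernoulliDiff a (2 * j + 2) v) := by
    apply intervalIntegral.integral_congr_Ioo_of_le (by norm_num)
    intro v hv
    simp only
    rw [← habs, abs_of_nonpos (bernoulliDiff_even_sign j ha ⟨hv.1.le, hv.2.le⟩)]
  have hodd : ∀ t, perBernoulli (2 * j + 3) (-t) = -perBernoulli (2 * j + 3) t := fun t => by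
    rw [perBernoulli_neg (Or.inl (by omega)), Odd.neg_one_pow ⟨j + 1, by ring⟩, neg_one_mul]
  have hp : ∀ t ∈ Icc (0 : ℝ) (1 / 2), perBernoulli (2 * j + 3) t = normBernoulli (2 * j + 3) t :=
    fun t ht => perBernoulli_of_mem_Icc (by omega) ⟨ht.1, by linarith [ht.2]⟩
  have e1 : bernoulliDiff a (2 * j + 2 + 1) 0 = 2 * normBernoulli (2 * j + 3) a := by
    rw [bernoulliDiff, zero_add, zero_sub, hodd, hp a ha]
    ring
  have e2 : bernoulliDiff a (2 * j + 2 + 1) (1 / 2) =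
      -2 * normBernoulli (2 * j + 3) (1 / 2 - a) := by
    have e : (1 / 2 + a : ℝ) = -(1 / 2 - a) + 1 := by ring
    rw [bernoulliDiff, e, perBernoulli_periodic, hodd,
      hp _ ⟨by linarith [ha.2], by linarith [ha.1]⟩]
    ring
  rw [h1, intervalIntegral.integral_neg, intervalIntegral.integral_const_mul,
    integral_bernoulliDiff a (by omega), e1, e2]
  refine (le_abs_self _).trans ?_
  rw [abs_neg, habs]
  have e3 : -2 * normBernoulli (2 * j + 3) (1 / 2 - a) - 2 * normBernoulli (2 * j + 3) a =
      -(2 * (normBernoulli (2 * j + 3) a + normBernoulli (2 * j + 3) (1 / 2 - a))) := by ring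
  rw [e3, abs_neg, abs_mul, abs_two]
  linarith [normBernoulli_add_half_sub_le j ha]

/-! ### Bernoulli values and the constants `K_n` -/

theorem favardConst_odd (j : ℕ) : (favardConst (2 * j + 1) : ℝ) =
    2 * |normBernoulli (2 * j + 2) 0 - normBernoulli (2 * j + 2) (1 / 2)| := by
  have hpow : (1 : ℝ) ≤ 2 ^ (2 * j + 2) := one_le_pow₀ (by norm_num)
  have h : normBernoulli (2 * j + 2) 0 - normBernoulli (2 * j + 2) (1 / 2) =
      (bernoulli (2 * j + 2) : ℝ) *
        ((2 ^ (2 * j + 2) - 1) / (2 ^ (2 * j + 1) * ((2 * j + 2).factorial : ℝ))) := by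
    have : ((2 * j + 2).factorial : ℝ) ≠ 0 := by positivity
    rw [normBernoulli, normBernoulli, bernoulliFun_eval_zero, one_div, bernoulliFun_eval_half]
    field_simp
    ring
  rw [h, abs_mul, abs_of_nonneg (div_nonneg (by linarith) (by positivity) :
    0 ≤ (2 ^ (2 * j + 2) - 1) / (2 ^ (2 * j + 1) * ((2 * j + 2).factorial : ℝ))), favardConst,
    if_pos ⟨j, rfl⟩]
  have e : 2 * j + 1 - 1 = 2 * j := by omega
  rw [e]
  push_cast
  have : ((2 * j + 2).factorial : ℝ) ≠ 0 := by positivity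
  have e2 : 2 * j + 1 + 1 = 2 * j + 2 := by ring
  rw [e2]
  field_simp
  ring

open PowerSeries in
-- Coefficient `n + 1` of `2 X (e^(X/4) - e^(3X/4)) / (e^X - 1) = -X / cosh(X/4)`, which follows
-- from `(e^(X/4) + e^(-X/4)) (e^(3X/4) - e^(X/4)) = e^X - 1`.
theorem bernoulli_quarter_sub (n : ℕ) :
    2 * (((Polynomial.bernoulli (n + 1)).eval (1 / 4 : ℚ) -
      (Polynomial.bernoulli (n + 1)).eval (3 / 4 : ℚ)) / ((n + 1).factorial : ℚ)) =
      -(eulerNumber n / (4 ^ n * (n.factorial : ℚ))) := by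
  set H : PowerSeries ℚ := C (1 / 2 : ℚ) * (exp ℚ + evalNegHom (exp ℚ)) with hH
  set e : ℚ → PowerSeries ℚ := fun c => rescale c (exp ℚ) with he
  have hadd : ∀ a b, e a * e b = e (a + b) := fun a b => exp_mul_exp_eq_exp_add a b
  have e1 : e 1 = exp ℚ := by simp [he]
  have e0 : e 0 = 1 := by simp [he]
  set P : ℚ → PowerSeries ℚ := fun t =>
    PowerSeries.mk fun n => Polynomial.aeval t ((1 / n.factorial : ℚ) • Polynomial.bernoulli n)
    with hP
  have hgen : ∀ t, P t * (e 1 - 1) = X * e t := fun t => by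
    rw [e1]; exact Polynomial.bernoulli_generating_function t
  have hC : rescale (1 / 4 : ℚ) (C (1 / 2 : ℚ)) = C (1 / 2 : ℚ) := by
    ext k
    rw [coeff_rescale, coeff_C]
    split_ifs with hk <;> simp [hk]
  have hH4 : C (2 : ℚ) * rescale (1 / 4 : ℚ) H = e (1 / 4) + e (-(1 / 4)) := by
    rw [hH, map_mul, map_add, hC, evalNegHom, rescale_rescale, ← mul_assoc, ← map_mul]
    norm_num [he]
  have hne : e (3 / 4) - e (1 / 4) ≠ 0 := fun h => by
    have := congrArg (coeff 1) h
    norm_num [he, coeff_rescale, coeff_exp] at this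
  have hkey : C (2 : ℚ) * (P (1 / 4) - P (3 / 4)) * rescale (1 / 4 : ℚ) H = -X := by
    apply mul_right_cancel₀ hne
    have h1 : (e (1 / 4) + e (-(1 / 4))) * (e (3 / 4) - e (1 / 4)) = e 1 - 1 := by
      have a1 := hadd (1 / 4) (3 / 4)
      have a2 := hadd (1 / 4) (1 / 4)
      have a3 := hadd (-(1 / 4)) (3 / 4)
      have a4 := hadd (-(1 / 4)) (1 / 4)
      norm_num at a1 a2 a3 a4
      rw [e0] at a4
      norm_num
      linear_combination a1 - a2 + a3 - a4
    linear_combination (P (1 / 4) - P (3 / 4)) * (e (3 / 4) - e (1 / 4)) * hH4 +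
      (P (1 / 4) - P (3 / 4)) * h1 + hgen (1 / 4) - hgen (3 / 4)
  have hHc : constantCoeff H ≠ 0 := by
    rw [hH, ← coeff_zero_eq_constantCoeff_apply, coeff_C_mul, map_add, evalNegHom, coeff_rescale]
    norm_num [coeff_exp]
  have hHinv : rescale (1 / 4 : ℚ) H * rescale (1 / 4 : ℚ) H⁻¹ = 1 := by
    rw [← map_mul, PowerSeries.mul_inv_cancel _ hHc, map_one]
  have hfin : C (2 : ℚ) * (P (1 / 4) - P (3 / 4)) = -(X * rescale (1 / 4 : ℚ) H⁻¹) := by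
    linear_combination rescale (1 / 4 : ℚ) H⁻¹ * hkey -
      C (2 : ℚ) * (P (1 / 4) - P (3 / 4)) * hHinv
  have hc := congrArg (coeff (n + 1)) hfin
  rw [coeff_C_mul, map_sub, map_neg, coeff_succ_X_mul, coeff_rescale] at hc
  simp only [hP, coeff_mk, map_smul, smul_eq_mul, Polynomial.coe_aeval_eq_eval] at hc
  have hE : eulerNumber n = n.factorial * coeff n H⁻¹ := rfl
  have hn : (n.factorial : ℚ) ≠ 0 := by positivity
  rw [hE, mul_div_mul_comm, mul_comm]
  rw [div_pow, one_pow] at hc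
  field_simp at hc ⊢
  linarith

theorem favardConst_even (j : ℕ) : (favardConst (2 * j + 2) : ℝ) =
    4 * |normBernoulli (2 * j + 3) (1 / 4)| := by
  have h := congrArg (fun q : ℚ => (q : ℝ)) (bernoulli_quarter_sub (2 * j + 2))
  have hb : ∀ (k : ℕ) (q : ℚ), (((Polynomial.bernoulli k).eval q : ℚ) : ℝ) =
      bernoulliFun k q := fun k q => by
    rw [bernoulliFun, Polynomial.eval_map_algebraMap]
    have := Polynomial.aeval_algebraMap_apply ℝ q (Polynomial.bernoulli k)
    simpa using this.symm
  push_cast [hb] at h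
  have h3 : normBernoulli (2 * j + 3) (3 / 4) = -normBernoulli (2 * j + 3) (1 / 4) := by
    have := normBernoulli_one_sub (2 * j + 3) (1 / 4)
    rw [Odd.neg_one_pow ⟨j + 1, by ring⟩] at this
    norm_num at this ⊢
    exact this
  rw [sub_div] at h
  change 2 * (normBernoulli (2 * j + 3) (1 / 4) - normBernoulli (2 * j + 3) (3 / 4)) = _ at h
  rw [h3] at h
  have h4 : 4 * normBernoulli (2 * j + 3) (1 / 4) =
      -((eulerNumber (2 * j + 2) : ℝ) / (4 ^ (2 * j + 2) * ((2 * j + 2).factorial : ℝ))) := by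
    linarith
  have h5 : ¬ Odd (2 * j + 2) := Nat.not_odd_iff_even.2 ⟨j + 1, by ring⟩
  have h6 : 4 * |normBernoulli (2 * j + 3) (1 / 4)| = |4 * normBernoulli (2 * j + 3) (1 / 4)| := by
    rw [abs_mul, abs_of_pos (four_pos : (0 : ℝ) < 4)]
  rw [favardConst, if_neg h5, h6, h4, abs_neg, abs_div]
  push_cast
  rw [abs_of_pos (by positivity : (0 : ℝ) < 4 ^ (2 * j + 2) * ((2 * j + 2).factorial : ℝ))]

theorem integral_abs_bernoulliDiff_le {n : ℕ} (hn : 1 ≤ n) {a : ℝ}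
    (ha : a ∈ Icc (0 : ℝ) (1 / 2)) :
    ∫ v in (0 : ℝ)..1, |bernoulliDiff a n v| ≤ 2 * favardConst n := by
  rw [integral_abs_bernoulliDiff]
  gcongr
  rcases Nat.even_or_odd' n with ⟨j, rfl | rfl⟩
  · obtain ⟨i, rfl⟩ : ∃ i, j = i + 1 := ⟨j - 1, by omega⟩
    have e : 2 * (i + 1) = 2 * i + 2 := by ring
    rw [e, favardConst_even]
    exact integral_abs_bernoulliDiff_even_le i ha
  · rw [favardConst_odd]
    exact integral_abs_bernoulliDiff_odd_le j ha

/-! ### Integral representation and the oscillation estimate -/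

/-- A chain `f 0, …, f n` of functions on `[0, T]`, each absolutely continuous with the next one as
its derivative almost everywhere, and with periodic boundary values. -/
structure PeriodicChain (T : ℝ) (n : ℕ) (f : ℕ → ℝ → ℝ) : Prop where
  ac : ∀ i < n, AbsolutelyContinuousOnInterval (f i) 0 T
  hasDerivAt : ∀ i < n, ∀ᵐ s : ℝ, s ∈ Icc 0 T → HasDerivAt (f i) (f (i + 1) s) s
  periodic : ∀ i < n, f i 0 = f i T

/-- Integral of the `k`-th function of the chain against the periodized Bernoulli kernel, written
with polynomials on the two subintervals. -/
noncomputable def bernoulliTransform (T : ℝ) (f : ℕ → ℝ → ℝ) (k : ℕ) (t : ℝ) : ℝ :=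
  (∫ s in (0 : ℝ)..t, normBernoulli k ((t - s) / T + 0) * f k s) +
    ∫ s in t..T, normBernoulli k ((t - s) / T + 1) * f k s

/-- Integration by parts for absolutely continuous functions; the shift `c` is `0` for `s < t` and
`1` for `s > t`, matching the fractional part of `(t - s) / T`. -/
theorem integral_normBernoulli_mul_deriv {T u v : ℝ} (t c : ℝ) (k : ℕ)
    {f g : ℝ → ℝ} (hu : u ∈ Icc 0 T) (hv : v ∈ Icc 0 T)
    (hf : AbsolutelyContinuousOnInterval f 0 T)
    (hd : ∀ᵐ s : ℝ, s ∈ Icc 0 T → HasDerivAt f (g s) s) :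
    ∫ s in u..v, normBernoulli (k + 1) ((t - s) / T + c) * g s =
      normBernoulli (k + 1) ((t - v) / T + c) * f v -
        normBernoulli (k + 1) ((t - u) / T + c) * f u +
        T⁻¹ * ∫ s in u..v, normBernoulli k ((t - s) / T + c) * f s := by
  have hφ : ∀ s, HasDerivAt (fun s => normBernoulli (k + 1) ((t - s) / T + c))
      (-T⁻¹ * normBernoulli k ((t - s) / T + c)) s := fun s => by
    have h1 : HasDerivAt (fun s : ℝ => (t - s) / T + c) (-1 / T) s :=
      (((hasDerivAt_id s).const_sub t).div_const T).add_const c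
    have h2 : HasDerivAt (fun s => normBernoulli (k + 1) ((t - s) / T + c))
        (normBernoulli k ((t - s) / T + c) * (-1 / T)) s :=
      HasDerivAt.comp (h₂ := normBernoulli (k + 1)) s (hasDerivAt_normBernoulli k _) h1
    convert h2 using 1
    ring
  have hφac : AbsolutelyContinuousOnInterval
      (fun s => normBernoulli (k + 1) ((t - s) / T + c)) u v := by
    apply ContDiffOn.absolutelyContinuousOnInterval
    apply ContDiff.contDiffOn
    rw [contDiff_one_iff_deriv]
    refine ⟨fun s => (hφ s).differentiableAt, ?_⟩
    rw [funext fun s => (hφ s).deriv]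
    fun_prop
  have hsub : uIcc u v ⊆ uIcc 0 T := by
    rw [uIcc_of_le (hu.1.trans hu.2)]
    exact uIcc_subset_Icc hu hv
  have hfac := hf.mono hsub
  have h := hφac.integral_mul_deriv_eq_deriv_mul hfac
  have e1 : ∫ s in u..v, normBernoulli (k + 1) ((t - s) / T + c) * deriv f s =
      ∫ s in u..v, normBernoulli (k + 1) ((t - s) / T + c) * g s := by
    apply intervalIntegral.integral_congr_ae
    filter_upwards [hd] with s hs hmem
    rw [(hs (uIcc_subset_Icc hu hv (uIoc_subset_uIcc hmem))).deriv]
  rw [← e1, h, ← intervalIntegral.integral_const_mul, sub_eq_add_neg _ (∫ s in u..v, _),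
    ← intervalIntegral.integral_neg]
  congr 1
  apply intervalIntegral.integral_congr
  intro s _
  simp only [(hφ s).deriv]
  ring

namespace PeriodicChain

variable {T : ℝ} {n : ℕ} {f : ℕ → ℝ → ℝ}

/-- The boundary terms at `0` and `T` cancel by periodicity, leaving only the jump of the kernel at
`s = t`. That jump is `-1` for `k = 0` and zero afterwards. -/
theorem bernoulliTransform_succ (hT : 0 < T) (hf : PeriodicChain T n f) {k : ℕ} (hk : k < n)
    {t : ℝ} (ht : t ∈ Icc 0 T) :
    bernoulliTransform T f (k + 1) t =
      (normBernoulli (k + 1) 0 - normBernoulli (k + 1) 1) * f k t +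
        T⁻¹ * bernoulliTransform T f k t := by
  have m0 : (0 : ℝ) ∈ Icc 0 T := ⟨le_rfl, hT.le⟩
  have mT : T ∈ Icc 0 T := ⟨hT.le, le_rfl⟩
  rw [bernoulliTransform, bernoulliTransform,
    integral_normBernoulli_mul_deriv t 0 k m0 ht (hf.ac k hk) (hf.hasDerivAt k hk),
    integral_normBernoulli_mul_deriv t 1 k ht mT (hf.ac k hk) (hf.hasDerivAt k hk),
    hf.periodic k hk]
  have e : (t - T) / T + 1 = (t - 0) / T + 0 := by
    field_simp
    ring
  rw [e]
  simp only [sub_self, zero_div, zero_add]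
  ring

theorem eq_mean_sub_bernoulliTransform (hT : 0 < T) (hf : PeriodicChain T n f) {k : ℕ}
    (hk : k < n) {t : ℝ} (ht : t ∈ Icc 0 T) :
    f 0 t = T⁻¹ * (∫ s in (0 : ℝ)..T, f 0 s) - T ^ k * bernoulliTransform T f (k + 1) t := by
  induction k with
  | zero =>
    have hcont := (hf.ac 0 hk).continuousOn
    rw [uIcc_of_le hT.le] at hcont
    have hi : ∀ u ∈ Icc 0 T, ∀ v ∈ Icc 0 T, IntervalIntegrable (f 0) volume u v :=
      fun u hu v hv => (hcont.mono (uIcc_subset_Icc hu hv)).intervalIntegrable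
    rw [hf.bernoulliTransform_succ hT hk ht, bernoulliTransform]
    simp only [normBernoulli_zero, one_mul, zero_add, normBernoulli_one, pow_zero]
    rw [intervalIntegral.integral_add_adjacent_intervals (hi 0 ⟨le_rfl, hT.le⟩ t ht)
      (hi t ht T ⟨hT.le, le_rfl⟩)]
    ring
  | succ k ih =>
    rw [ih (by omega), hf.bernoulliTransform_succ hT hk ht, normBernoulli_eval_one (by omega)]
    field_simp
    ring

theorem intervalIntegrable_perBernoulli_mul {g : ℝ → ℝ}
    (hg : IntervalIntegrable g volume 0 T) (k : ℕ) (t : ℝ) :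
    IntervalIntegrable (fun s => perBernoulli k ((t - s) / T) * g s) volume 0 T := by
  obtain ⟨C, hC⟩ := exists_abs_perBernoulli_le k
  rw [intervalIntegrable_iff] at hg ⊢
  refine hg.bdd_mul (c := C) ?_ (Filter.Eventually.of_forall fun s => hC _)
  exact ((measurable_perBernoulli k).comp (by fun_prop)).aestronglyMeasurable

theorem bernoulliTransform_eq (hT : 0 < T) {t : ℝ} (ht : t ∈ Icc 0 T) (k : ℕ)
    (hg : IntervalIntegrable (f k) volume 0 T) :
    bernoulliTransform T f k t = ∫ s in (0 : ℝ)..T, perBernoulli k ((t - s) / T) * f k s := by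
  have hi := intervalIntegrable_perBernoulli_mul hg k t
  have ht' : t ∈ uIcc 0 T := by rwa [uIcc_of_le hT.le]
  rw [← intervalIntegral.integral_add_adjacent_intervals (b := t)
    (hi.mono_set (uIcc_subset_uIcc left_mem_uIcc ht'))
    (hi.mono_set (uIcc_subset_uIcc ht' right_mem_uIcc)), bernoulliTransform]
  congr 1
  · apply intervalIntegral.integral_congr_Ioo_of_le ht.1
    intro s hs
    simp only
    rw [perBernoulli_of_mem_Ico ⟨div_nonneg (by linarith [hs.2]) hT.le, ?_⟩, add_zero]
    rw [div_lt_one hT]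
    linarith [hs.1, ht.2]
  · apply intervalIntegral.integral_congr_Ioo_of_le ht.2
    intro s hs
    simp only
    rw [← perBernoulli_periodic, perBernoulli_of_mem_Ico ⟨?_, ?_⟩]
    · have : -1 ≤ (t - s) / T := by
        rw [le_div_iff₀ hT]
        linarith [hs.2, ht.1]
      linarith
    · have : (t - s) / T < 0 := div_neg_of_neg_of_pos (by linarith [hs.1]) hT
      linarith

end PeriodicChain

theorem integral_comp_sub_div_of_periodic {g : ℝ → ℝ} (hg : Function.Periodic g 1) {T : ℝ}
    (hT : 0 < T) (t : ℝ) :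
    ∫ s in (0 : ℝ)..T, g ((t - s) / T) = T * ∫ v in (0 : ℝ)..1, g v := by
  have h1 := intervalIntegral.integral_comp_sub_left (a := 0) (b := T) (fun s => g (s / T)) t
  have h2 := hg.intervalIntegral_add_eq ((t - T) / T) 0
  have e : (t - T) / T + 1 = (t - 0) / T := by
    field_simp
    ring
  rw [h1, intervalIntegral.integral_comp_div _ hT.ne', smul_eq_mul, ← e, h2, zero_add]

theorem PeriodicChain.abs_sub_le {T : ℝ} {n : ℕ} {f : ℕ → ℝ → ℝ} (hT : 0 < T) (hn : 1 ≤ n)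
    (hf : PeriodicChain T n f) {lo hi : ℝ}
    (hb : ∀ᵐ s : ℝ, s ∈ Icc 0 T → f n s ∈ Icc lo hi) {p q : ℝ} (hp : p ∈ Icc 0 T)
    (hq : q ∈ Icc 0 T) : |f 0 p - f 0 q| ≤ favardConst n * T ^ n * (hi - lo) := by
  wlog hpq : p ≤ q generalizing p q
  · rw [abs_sub_comm]
    exact this hq hp (by linarith)
  obtain ⟨k, rfl⟩ : ∃ k, n = k + 1 := ⟨n - 1, by omega⟩
  have hint : IntervalIntegrable (f (k + 1)) volume 0 T := by
    refine (hf.ac k (by omega)).intervalIntegrable_deriv.congr_ae ?_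
    rw [Filter.EventuallyEq, ae_restrict_iff' measurableSet_uIoc]
    filter_upwards [hf.hasDerivAt k (by omega)] with s hs hmem
    exact (hs (by rw [uIoc_of_le hT.le] at hmem; exact Ioc_subset_Icc_self hmem)).deriv
  -- Recentring at the midpoint halves the bound: `|f n - mid| ≤ (hi - lo) / 2`.
  set mid : ℝ := (lo + hi) / 2 with hmid
  have hker : ∀ t, ∫ s in (0 : ℝ)..T, perBernoulli (k + 1) ((t - s) / T) * mid = 0 := fun t => by
    rw [intervalIntegral.integral_mul_const,
      integral_comp_sub_div_of_periodic (perBernoulli_periodic _) hT,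
      integral_perBernoulli (by omega)]
    have := perBernoulli_periodic (k + 1 + 1) 0
    rw [zero_add] at this
    rw [this]
    ring
  have hi0 := fun t => PeriodicChain.intervalIntegrable_perBernoulli_mul hint (k + 1) t
  have hi1 := fun t => PeriodicChain.intervalIntegrable_perBernoulli_mul (T := T) (g := fun _ => mid)
    intervalIntegrable_const (k + 1) t
  have hrep : f 0 p - f 0 q = T ^ k * ∫ s in (0 : ℝ)..T,
      (perBernoulli (k + 1) ((q - s) / T) - perBernoulli (k + 1) ((p - s) / T)) *
        (f (k + 1) s - mid) := by
    have e : ∀ s, (perBernoulli (k + 1) ((q - s) / T) - perBernoulli (k + 1) ((p - s) / T)) *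
        (f (k + 1) s - mid) = (perBernoulli (k + 1) ((q - s) / T) * f (k + 1) s -
          perBernoulli (k + 1) ((q - s) / T) * mid) -
          (perBernoulli (k + 1) ((p - s) / T) * f (k + 1) s -
          perBernoulli (k + 1) ((p - s) / T) * mid) := fun s => by ring
    simp only [e]
    rw [intervalIntegral.integral_sub ((hi0 q).sub (hi1 q)) ((hi0 p).sub (hi1 p)),
      intervalIntegral.integral_sub (hi0 q) (hi1 q), intervalIntegral.integral_sub (hi0 p) (hi1 p),
      hker, hker, hf.eq_mean_sub_bernoulliTransform hT (k := k) (by omega) hp,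
      hf.eq_mean_sub_bernoulliTransform hT (k := k) (by omega) hq,
      PeriodicChain.bernoulliTransform_eq hT hp _ hint,
      PeriodicChain.bernoulliTransform_eq hT hq _ hint]
    ring
  -- Half-distance (scaled by `T`) and midpoint of `p` and `q`; `q - p ≤ T` gives `a ≤ 1/2`.
  set a : ℝ := (q - p) / (2 * T) with ha
  set c : ℝ := (p + q) / 2 with hc
  have hD : ∀ s, perBernoulli (k + 1) ((q - s) / T) - perBernoulli (k + 1) ((p - s) / T) =
      bernoulliDiff a (k + 1) ((c - s) / T) := fun s => by
    have e1 : (q - s) / T = (c - s) / T + a := by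
      rw [ha, hc]; field_simp; ring
    have e2 : (p - s) / T = (c - s) / T - a := by
      rw [ha, hc]; field_simp; ring
    rw [bernoulliDiff, e1, e2]
  have ha' : a ∈ Icc (0 : ℝ) (1 / 2) := by
    refine ⟨div_nonneg (by linarith) (by linarith), ?_⟩
    rw [ha, div_le_div_iff₀ (by linarith) two_pos]
    linarith [hp.1, hq.2]
  have hiD : IntervalIntegrable (fun s => |bernoulliDiff a (k + 1) ((c - s) / T)|) volume 0 T := by
    simp only [← hD]
    exact ((intervalIntegrable_perBernoulli_comp (by fun_prop) _ _ _).sub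
      (intervalIntegrable_perBernoulli_comp (by fun_prop) _ _ _)).abs
  have hbound : |∫ s in (0 : ℝ)..T, bernoulliDiff a (k + 1) ((c - s) / T) * (f (k + 1) s - mid)| ≤
      ∫ s in (0 : ℝ)..T, |bernoulliDiff a (k + 1) ((c - s) / T)| * ((hi - lo) / 2) := by
    rw [← Real.norm_eq_abs]
    apply intervalIntegral.norm_integral_le_of_norm_le hT.le _ (hiD.mul_const _)
    filter_upwards [hb] with s hs hmem
    obtain ⟨h1, h2⟩ := hs (Ioc_subset_Icc_self hmem)
    rw [Real.norm_eq_abs, abs_mul]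
    gcongr
    exact abs_le.2 ⟨by rw [hmid]; linarith, by rw [hmid]; linarith⟩
  have hlohi : lo ≤ hi := by
    have : ∃ s, s ∈ Icc 0 T ∧ (s ∈ Icc 0 T → f (k + 1) s ∈ Icc lo hi) := by
      have h0 : volume (Icc 0 T) ≠ 0 := by simp [hT]
      exact (frequently_ae_mem_iff.2 h0).and_eventually hb |>.exists
    obtain ⟨s, hs, h⟩ := this
    exact (h hs).1.trans (h hs).2
  have hper : Function.Periodic (fun v => |bernoulliDiff a (k + 1) v|) 1 := fun v => by
    simp only [bernoulliDiff_periodic a (k + 1) v]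
  rw [hrep, abs_mul, abs_of_nonneg (pow_nonneg hT.le k)]
  simp only [hD]
  rw [intervalIntegral.integral_mul_const,
    integral_comp_sub_div_of_periodic (g := fun v => |bernoulliDiff a (k + 1) v|) hper hT] at hbound
  calc _ ≤ T ^ k * (T * (2 * favardConst (k + 1)) * ((hi - lo) / 2)) := by
        refine mul_le_mul_of_nonneg_left (hbound.trans ?_) (pow_nonneg hT.le k)
        refine mul_le_mul_of_nonneg_right ?_ (by linarith)
        exact mul_le_mul_of_nonneg_left (integral_abs_bernoulliDiff_le (by omega) ha') hT.le
    _ = _ := by ring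

/-! ### Application to the boundary value problem -/

theorem AbsolutelyContinuousOnInterval.pi_apply {ι : Type*} [Fintype ι] {g : ℝ → ι → ℝ} {a b : ℝ}
    (hg : AbsolutelyContinuousOnInterval g a b) (j : ι) :
    AbsolutelyContinuousOnInterval (fun t => g t j) a b :=
  squeeze_zero (fun _ => Finset.sum_nonneg fun _ _ => dist_nonneg)
    (fun _ => Finset.sum_le_sum fun _ _ => dist_le_pi_dist _ _ j) hg

theorem derivOn_zero_apply {T : ℝ} {m : ℕ} (hT : 0 < T) (x : ContSpace T m)
    (t : Icc (0 : ℝ) T) : derivOn hT 0 x t = x t := by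
  rw [derivOn, iteratedDerivWithin_zero, IccExtend_val]

theorem IsPeriodicSolution.periodicChain {T : ℝ} {m n : ℕ} {hT : 0 < T}
    {F : ContSpace T m → LInfSpace T m} {x : ContSpace T m} (hx : IsPeriodicSolution hT n F x)
    (j : Fin m) : PeriodicChain T n (fun i t => derivOn hT i x t j) where
  ac i hi := (hx.ac.2 i hi).pi_apply j
  hasDerivAt i hi := by
    have h1 : ∀ᵐ s : ℝ, ∀ l : Fin m, s ∈ uIcc 0 T →
        DifferentiableAt ℝ (fun t => derivOn hT i x t l) s :=
      ae_all_iff.2 fun l => ((hx.ac.2 i hi).pi_apply l).ae_differentiableAt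
    -- Away from the end points, the derivative within `[0, T]` is the ordinary one.
    filter_upwards [h1, volume.ae_ne 0, volume.ae_ne T] with s hs h0 hT' hmem
    have hd : DifferentiableAt ℝ (derivOn hT i x) s :=
      differentiableAt_pi.2 fun l => hs l (by rwa [uIcc_of_le hT.le])
    have hnhds : Icc 0 T ∈ nhds s :=
      Icc_mem_nhds (lt_of_le_of_ne hmem.1 (Ne.symm h0)) (lt_of_le_of_ne hmem.2 hT')
    have e : derivOn hT (i + 1) x s = deriv (derivOn hT i x) s := by
      rw [derivOn, iteratedDerivWithin_succ, derivWithin_of_mem_nhds hnhds]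
      rfl
    rw [e]
    exact hasDerivAt_pi.1 hd.hasDerivAt j
  periodic i hi := congrFun (hx.periodic i hi) j

/-- Real-valued `essSup` and `essInf` are meaningful only under boundedness, which membership in
`L_∞` supplies. -/
theorem ae_mem_Icc_essInf_essSup {T : ℝ} {m : ℕ} (z : LInfSpace T m) (j : Fin m) :
    ∀ᵐ t ∂(volIcc T), z t j ∈
      Icc (essInf (fun t : ℝ => z t j) (volIcc T)) (essSup (fun t : ℝ => z t j) (volIcc T)) := by
  obtain ⟨C, hC⟩ : ∃ C : ℝ, ∀ᵐ t ∂(volIcc T), ‖z t‖ ≤ C :=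
    ⟨_, ae_le_lpNorm_exponent_top (Lp.memLp z)⟩
  have hC' : ∀ᵐ t ∂(volIcc T), |z t j| ≤ C := hC.mono fun t ht => (norm_le_pi_norm _ j).trans ht
  have hup : Filter.IsBoundedUnder (· ≤ ·) (ae (volIcc T)) fun t => z t j :=
    ⟨C, Filter.eventually_map.2 (hC'.mono fun t ht => (abs_le.1 ht).2)⟩
  have hlow : Filter.IsBoundedUnder (· ≥ ·) (ae (volIcc T)) fun t => z t j :=
    ⟨-C, Filter.eventually_map.2 (hC'.mono fun t ht => (abs_le.1 ht).1)⟩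
  filter_upwards [ae_le_essSup hup, ae_essInf_le hlow] with t h1 h2 using ⟨h2, h1⟩

theorem favardConst_nonneg (n : ℕ) : 0 ≤ favardConst n := by
  unfold favardConst
  split_ifs
  · have : (1 : ℚ) ≤ 2 ^ (n + 1) := one_le_pow₀ (by norm_num)
    exact div_nonneg (mul_nonneg (by linarith) (abs_nonneg _)) (by positivity)
  · positivity

theorem IsPeriodicSolution.sub_le {T : ℝ} {m n : ℕ} {hT : 0 < T} (hn : 1 ≤ n)
    {F : ContSpace T m → LInfSpace T m} {x : ContSpace T m} (hx : IsPeriodicSolution hT n F x)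
    (p q : Icc (0 : ℝ) T) (j : Fin m) :
    x p j - x q j ≤ favardConst n * T ^ n * maxEssOsc (F x) := by
  have hb : ∀ᵐ s : ℝ, s ∈ Icc 0 T → derivOn hT n x s j ∈
      Icc (essInf (fun t : ℝ => F x t j) (volIcc T))
        (essSup (fun t : ℝ => F x t j) (volIcc T)) := by
    rw [← ae_restrict_iff' measurableSet_Icc]
    filter_upwards [hx.eqn, ae_mem_Icc_essInf_essSup (F x) j] with s h1 h2
    rwa [h1]
  have h := (hx.periodicChain j).abs_sub_le hT hn hb p.2 q.2
  simp only [derivOn_zero_apply] at h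
  have hK : (0 : ℝ) ≤ favardConst n := by exact_mod_cast favardConst_nonneg n
  refine (le_abs_self _).trans (h.trans (mul_le_mul_of_nonneg_left ?_ (by positivity)))
  exact le_ciSup (f := fun i : Fin m => essSup (fun t : ℝ => F x t i) (volIcc T) -
    essInf (fun t : ℝ => F x t i) (volIcc T)) (finite_range _).bddAbove j

theorem IsPeriodicSolution.maxOsc_le {T : ℝ} {m n : ℕ} [NeZero m] {hT : 0 < T} (hn : 1 ≤ n)
    {F : ContSpace T m → LInfSpace T m} {x : ContSpace T m} (hx : IsPeriodicSolution hT n F x) :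
    maxOsc x ≤ favardConst n * T ^ n * maxEssOsc (F x) := by
  have : Nonempty (Icc (0 : ℝ) T) := ⟨⟨0, le_rfl, hT.le⟩⟩
  refine ciSup_le fun j => ?_
  rw [sub_le_comm]
  refine le_ciInf fun q => ?_
  rw [sub_le_comm, ← sub_nonneg, sub_sub_eq_add_sub, sub_nonneg]
  refine ciSup_le fun p => ?_
  linarith [hx.sub_le hn p q j]

theorem sub_le_maxOsc {T : ℝ} {m : ℕ} (x : ContSpace T m) (p q : Icc (0 : ℝ) T) (j : Fin m) :
    x p j - x q j ≤ maxOsc x := by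
  have hc : Continuous fun t => x t j := (continuous_apply j).comp x.continuous
  have h1 := le_ciSup (isCompact_range hc).bddAbove p
  have h2 := ciInf_le (isCompact_range hc).bddBelow q
  have h3 := le_ciSup (f := fun i : Fin m => (⨆ t : Icc (0 : ℝ) T, x t i) -
    ⨅ t : Icc (0 : ℝ) T, x t i) (finite_range _).bddAbove j
  exact (sub_le_sub h1 h2).trans h3

theorem exists_lt_of_not_constant {T : ℝ} {m : ℕ} (hT : 0 < T) {x : ContSpace T m}
    (hx : ¬ ∃ c, ∀ t, x t = c) : ∃ (p q : Icc (0 : ℝ) T) (j : Fin m), x q j < x p j := by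
  by_contra! h
  exact hx ⟨x ⟨0, le_rfl, hT.le⟩, fun t => funext fun j => le_antisymm (h _ _ j) (h _ _ j)⟩

theorem theorem1 (n m : ℕ) (hn : 1 ≤ n) (T : ℝ) (hT : 0 < T) (L : ℝ) (hL : 0 < L)
    (F : ContSpace T m → LInfSpace T m)
    (hF : ∀ x : ContSpace T m, maxEssOsc (F x) ≤ L * maxOsc x)
    (hsol : ∃ x : ContSpace T m, IsPeriodicSolution hT n F x ∧ ¬ ∃ c, ∀ t, x t = c) :
    1 / (L * (favardConst n : ℝ)) ^ (1 / (n : ℝ)) ≤ T := by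
  obtain ⟨x, hx, hnc⟩ := hsol
  obtain ⟨p, q, j, hlt⟩ := exists_lt_of_not_constant hT hnc
  have : NeZero m := ⟨by rintro rfl; exact j.elim0⟩
  have hpos : 0 < maxOsc x := (sub_pos.2 hlt).trans_le (sub_le_maxOsc x p q j)
  have hK0 : (0 : ℝ) ≤ favardConst n := by exact_mod_cast favardConst_nonneg n
  have h1 : maxOsc x ≤ L * favardConst n * T ^ n * maxOsc x := by
    have h := mul_le_mul_of_nonneg_left (hF x) (mul_nonneg hK0 (pow_nonneg hT.le n))
    linarith [hx.maxOsc_le hn]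
  have h2 : 1 ≤ L * favardConst n * T ^ n := by
    by_contra! h
    nlinarith
  -- Positivity needs no arithmetic of Bernoulli or Euler numbers: `K_n = 0` would turn `h2` into `1
  -- ≤ 0`.
  have hK : (0 : ℝ) < favardConst n := by
    refine lt_of_le_of_ne hK0 fun h => ?_
    rw [← h] at h2
    norm_num at h2
  have hLK : 0 < L * (favardConst n : ℝ) := mul_pos hL hK
  have hn0 : n ≠ 0 := by omega
  rw [div_le_iff₀ (Real.rpow_pos_of_pos hLK _)]
  have h3 := Real.rpow_le_rpow zero_le_one h2 (by positivity : (0 : ℝ) ≤ 1 / n)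
  rw [Real.one_rpow, Real.mul_rpow hLK.le (by positivity), one_div,
    Real.pow_rpow_inv_natCast hT.le hn0] at h3
  rw [one_div, mul_comm]
  exact h3
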